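/- Let $V$ be a finite set, let $k\ge 1$ be an integer, and let $E$ be the set of all subsets of $V$ of cardinality at most $k$. Multisets below have subsets of $V$ as elements; $|G|$ is the number of elements of a multiset $G$ counted with multiplicity, and $G\oplus L$ is $G$ with one further copy of the set $L\subseteq V$ adjoined as an element. Sets $X,Y\subseteq V$ are connected by a multiset $H$ if there are $Z_1,\dots,Z_n\in H$ with $1\le n\le |H|$, $Z_1\cap X\ne\emptyset$, $Z_n\cap Y\ne\emptyset$ and $Z_j\cap Z_{j+1}\ne\emptyset$ for $1\le j<n$; the multiset $H$ is connected if any two of its elements (two occurrences, possibly of the same set) are connected by $H$ itself. For a set $W\subseteq V$ let $N(W|H)$ be the number of elements $Z$ of $H$, counted with multiplicity, with $Z\cap W\neq\emptyset$. Let $|\mathcal P(G)|$ be the number of multiset permutations of $G$, i.e. of distinct ordered sequences whose multiset of terms is $G$. Proposition (Cluster Summation). Let $\gamma\ge 0$ and let $\phi$ be a function from the subsets of $V$ to $\mathbb{R}_{\ge 0}$ such that $\sum_{Z\in E:\,Z\ni i}\phi(Z)\le\gamma$ for every $i\in V$. For $L\subseteq V$ and an integer $m\ge 0$ let $\mathcal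 G^E_m(L)$ be the set of all multisets $G=\{G_1,\dots,G_m\}$ of size $m$ with elements from $E$ such that $G\oplus L$ is connected. Then $$\sum_{G\in\mathcal G^E_m(L)}|\mathcal P(G)|\prod_{s=1}^m N(G_s|G\oplus L)\,\phi(G_s)\;\le\; c_1^{|L|/k}\,(c_2\gamma k)^m\, m!,\qquad c_1=e^{405},\quad c_2=e^{1231}.$$ -/

import Mathlib

namespace ClusterSum

variable {V : Type*} [DecidableEq V]

/-- Two vertex subsets overlap. -/
def Overlap (X Y : Finset V) : Prop := (X ∩ Y).Nonempty

instance (X Y : Finset V) : Decidable (Overlap X Y) := by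
  unfold Overlap; infer_instance

/-- `X` and `Y` are connected by the multiset `G`: there are `Z₁, …, Zₙ ∈ G` with
`1 ≤ n ≤ |G|`, such that `Z₁` meets `X`, `Zₙ` meets `Y`, and consecutive terms overlap. -/
def Connects (G : Multiset (Finset V)) (X Y : Finset V) : Prop :=
  ∃ (l : List (Finset V)) (hl : l ≠ []),
    l.length ≤ G.card ∧ (∀ Z ∈ l, Z ∈ G) ∧
    Overlap (l.head hl) X ∧ Overlap (l.getLast hl) Y ∧ l.IsChain Overlap

/-- A multiset of vertex subsets is connected if any pair of its elements is connected by the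
multiset itself. A pair is a two-element submultiset, so that two copies of the same subset are a
pair as soon as this subset has multiplicity at least two. -/
def IsConnected (G : Multiset (Finset V)) : Prop :=
  ∀ X Y : Finset V, ({X, Y} : Multiset (Finset V)) ≤ G → Connects G X Y

/-- The number `N(W | H)` of elements of the multiset `H`, with multiplicity, that overlap
with `W`. -/
def overlapCount (W : Finset V) (H : Multiset (Finset V)) : ℕ :=
  (H.filter fun Z => Overlap Z W).card

/-- The number `|𝒫(G)|` of multiset permutations of `G`, that is, of distinct ordered sequences
whose underlying multiset is `G`. -/
def numPerms (G : Multiset (Finset V)) : ℕ := G.lists.toFinset.card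

theorem mem_lists_toFinset {G : Multiset (Finset V)} {l : List (Finset V)} :
    l ∈ G.lists.toFinset ↔ (l : Multiset (Finset V)) = G := by
  rw [Multiset.mem_toFinset, Multiset.mem_lists_iff]
  exact eq_comm

/-- The set `E` of all vertex subsets of cardinality at most `k`. -/
def subsetsLE (V : Type*) [Fintype V] (k : ℕ) : Finset (Finset V) :=
  Finset.univ.filter fun Z => Z.card ≤ k

open Classical in
/-- The multisets `G` of size `m` with elements in `E` such that `G ⊕ L` is connected. -/
noncomputable def clusters [Fintype V] (k m : ℕ) (L : Finset V) :
    Finset (Multiset (Finset V)) :=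
  (((subsetsLE V k).sym m).image fun S : Sym (Finset V) m => (S : Multiset (Finset V))).filter
    fun G => IsConnected (L ::ₘ G)

theorem mem_clusters [Fintype V] {k m : ℕ} {L : Finset V} {G : Multiset (Finset V)} :
    G ∈ clusters k m L ↔
      (∀ Z ∈ G, Z.card ≤ k) ∧ G.card = m ∧ IsConnected (L ::ₘ G) := by
  classical
  simp only [clusters, Finset.mem_filter, Finset.mem_image, Finset.mem_sym_iff, subsetsLE,
    Finset.mem_univ, true_and]
  constructor
  · rintro ⟨⟨S, hS, rfl⟩, hc⟩
    exact ⟨fun Z hZ => hS Z hZ, S.2, hc⟩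
  · rintro ⟨h1, h2, hc⟩
    exact ⟨⟨⟨G, h2⟩, fun Z hZ => h1 Z hZ, rfl⟩, hc⟩

end ClusterSum

namespace ClusterSum

open Finset

/-! The weight `|𝒫(G)|` turns the sum over multisets into a sum over sequences `Z₁, …, Z_m`. Put the
root `L` at index `none` and take the overlap graph: it is connected, and each overlap count is at
most a degree plus one. The key fact is purely graph-theoretic: in a connected graph the product of
`deg + 1` over all vertices but one is at most `6 ^ (|W| - 1)` times the number of spanning trees
(`prod_degree_add_one_le_card_trees`). So overlap counts can be traded for trees. Orienting a tree
towards the root gives a parent function. For a fixed one, summing over the sets from the leaves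
inwards costs `γ` times the size of the parent set at each step (`sum_prod_overlap_le`). Summing
this bound over all functions, ranked or not, factorizes to `(γ(|L| + mk))^m`, and `y^m ≤ m! e^y`
finishes. -/

/-! ### Two preliminaries: expanding a product, and adding an edge to a graph. -/

/-- Keeps only the terms of order at most one in the added indicators when the right-hand product is
expanded. -/
theorem prod_add_sum_prod_erase_le {α : Type*} [DecidableEq α] (D : Finset α) (P : α → Prop)
    [DecidablePred P] (f : α → ℕ) :
    ∏ e ∈ D, f e + ∑ e ∈ D with P e, ∏ e' ∈ D.erase e, f e' ≤
      ∏ e ∈ D, (f e + if P e then 1 else 0) := by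
  induction D using Finset.induction_on with
  | empty => simp
  | insert a D ha ih =>
    have h1 : ∑ e ∈ insert a D with P e, ∏ e' ∈ (insert a D).erase e, f e' =
        (if P a then ∏ e ∈ D, f e else 0) +
          f a * ∑ e ∈ D with P e, ∏ e' ∈ D.erase e, f e' := by
      rw [sum_filter, sum_insert ha, erase_insert ha, sum_filter, mul_sum]
      congr 1
      refine sum_congr rfl fun e he => ?_
      have hne : a ≠ e := fun h => ha (h ▸ he)
      rw [erase_insert_of_ne hne, prod_insert (fun h => ha (mem_of_mem_erase h))]
      split_ifs <;> simp
    have h2 : ∏ e ∈ D, f e ≤ ∏ e ∈ D, (f e + if P e then 1 else 0) :=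
      prod_le_prod' fun e _ => Nat.le_add_right _ _
    rw [h1, prod_insert ha, prod_insert ha]
    split_ifs <;> nlinarith [Nat.mul_le_mul_left (f a) ih]

theorem reachable_sup_edge {W : Type*} {F : SimpleGraph W} {t u a b : W}
    (h : (F ⊔ SimpleGraph.edge t u).Reachable a b) :
    F.Reachable a b ∨ (F.Reachable a t ∧ F.Reachable u b) ∨
      (F.Reachable a u ∧ F.Reachable t b) := by
  obtain ⟨p⟩ := h
  induction p with
  | nil => exact Or.inl (.refl _)
  | @cons a c b hac _ ih =>
    rw [SimpleGraph.sup_adj, SimpleGraph.edge_adj] at hac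
    rcases hac with hac | ⟨⟨rfl, rfl⟩ | ⟨rfl, rfl⟩, -⟩
    · have h := hac.reachable
      rcases ih with ih | ⟨h1, h2⟩ | ⟨h1, h2⟩
      · exact .inl (h.trans ih)
      · exact .inr (.inl ⟨h.trans h1, h2⟩)
      · exact .inr (.inr ⟨h.trans h1, h2⟩)
    · rcases ih with ih | ⟨h1, h2⟩ | ⟨h1, h2⟩
      · exact .inr (.inl ⟨.refl _, ih⟩)
      · exact .inr (.inl ⟨.refl _, h2⟩)
      · exact .inl h2
    · rcases ih with ih | ⟨h1, h2⟩ | ⟨h1, h2⟩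
      · exact .inr (.inr ⟨.refl _, ih⟩)
      · exact .inl h2
      · exact .inr (.inr ⟨.refl _, h2⟩)

/-! ### Degree products and spanning trees -/

section SpanningTrees

open Classical

variable {W : Type*} [Fintype W]

/-- The spanning trees of `G` that contain the forest `F`. -/
noncomputable def treesBetween (F G : SimpleGraph W) : Finset (SimpleGraph W) :=
  {T | T.IsTree ∧ F ≤ T ∧ T ≤ G}

theorem mem_treesBetween {F G T : SimpleGraph W} :
    T ∈ treesBetween F G ↔ T.IsTree ∧ F ≤ T ∧ T ≤ G := by
  simp [treesBetween]

/-- The number of spanning trees of `G` containing `F`, where every edge outside `F` carries a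
label that is either blank or one of its endpoints in `Y`. -/
noncomputable def treeWeight (G : SimpleGraph W) (Y : Finset W) (F : SimpleGraph W) : ℕ :=
  ∑ T ∈ treesBetween F G, ∏ e ∈ T.edgeFinset \ F.edgeFinset, (1 + #{t ∈ Y | t ∈ e})

/-- Among the labelled trees keep those in which at most one edge carries the label `t`. If none
does, `t` can be dropped from `Y`; if exactly one edge `tu` does, move that edge into the forest. -/
theorem treeWeight_erase_add_sum_le (G F : SimpleGraph W) (Y : Finset W) {t : W} (ht : t ∈ Y) :
    treeWeight G (Y.erase t) F +
        ∑ u with G.Adj t u ∧ ¬ F.Reachable t u,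
          treeWeight G (Y.erase t) (F ⊔ SimpleGraph.edge t u) ≤
      treeWeight G Y F := by
  have key : ∀ T ∈ treesBetween F G,
      ∏ e ∈ T.edgeFinset \ F.edgeFinset, (1 + #{s ∈ Y.erase t | s ∈ e}) +
        ∑ u with (G.Adj t u ∧ ¬ F.Reachable t u) ∧ T.Adj t u,
          ∏ e ∈ T.edgeFinset \ (F ⊔ SimpleGraph.edge t u).edgeFinset,
            (1 + #{s ∈ Y.erase t | s ∈ e}) ≤
      ∏ e ∈ T.edgeFinset \ F.edgeFinset, (1 + #{s ∈ Y | s ∈ e}) := by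
    intro T hT
    set D := T.edgeFinset \ F.edgeFinset with hD
    have hw : ∀ e : Sym2 W, 1 + #{s ∈ Y | s ∈ e} =
        (1 + #{s ∈ Y.erase t | s ∈ e}) + if t ∈ e then 1 else 0 := by
      intro e
      conv_lhs => rw [← insert_erase ht, filter_insert]
      split_ifs
      · rw [card_insert_of_notMem (by simp)]; ring
      · ring
    simp_rw [hw]
    refine le_trans ?_ (prod_add_sum_prod_erase_le D (fun e => t ∈ e) _)
    gcongr
    have h1 : ∀ u ∈ ({u | (G.Adj t u ∧ ¬ F.Reachable t u) ∧ T.Adj t u} : Finset W),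
        ∏ e ∈ T.edgeFinset \ (F ⊔ SimpleGraph.edge t u).edgeFinset,
            (1 + #{s ∈ Y.erase t | s ∈ e}) =
          ∏ e ∈ D.erase s(t, u), (1 + #{s ∈ Y.erase t | s ∈ e}) := by
      intro u hu
      simp only [mem_filter, mem_univ, true_and] at hu
      congr 1
      ext e
      have : t ≠ u := hu.1.1.ne
      simp only [hD, mem_sdiff, mem_erase, SimpleGraph.mem_edgeFinset, SimpleGraph.edgeSet_sup,
        SimpleGraph.edgeSet_edge_of_ne this, Set.mem_union, Set.mem_singleton_iff]
      tauto
    rw [sum_congr rfl h1]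
    rw [← sum_image (f := fun e => ∏ e' ∈ D.erase e, (1 + #{s ∈ Y.erase t | s ∈ e'}))
      (g := fun u => s(t, u))]
    · refine sum_le_sum_of_subset fun e he => ?_
      obtain ⟨u, hu, rfl⟩ := mem_image.1 he
      simp only [mem_filter, mem_univ, true_and] at hu
      simp only [hD, mem_filter, mem_sdiff, SimpleGraph.mem_edgeFinset, SimpleGraph.mem_edgeSet,
        Sym2.mem_mk_left, and_true]
      exact ⟨hu.2, fun h => hu.1.2 h.reachable⟩
    · intro u _ v _ h
      exact Sym2.congr_right.1 h
  have hset : ∀ u ∈ ({u | G.Adj t u ∧ ¬ F.Reachable t u} : Finset W),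
      treeWeight G (Y.erase t) (F ⊔ SimpleGraph.edge t u) =
        ∑ T ∈ treesBetween F G, if T.Adj t u then
          ∏ e ∈ T.edgeFinset \ (F ⊔ SimpleGraph.edge t u).edgeFinset,
            (1 + #{s ∈ Y.erase t | s ∈ e}) else 0 := by
    intro u hu
    simp only [mem_filter, mem_univ, true_and] at hu
    rw [treeWeight, ← sum_filter]
    refine sum_congr ?_ fun _ _ => by congr!
    ext T
    simp only [mem_filter, mem_treesBetween, sup_le_iff, SimpleGraph.edge_le_iff,
      hu.1.ne, false_or]
    tauto
  rw [sum_congr rfl hset, sum_comm]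
  unfold treeWeight
  rw [← sum_add_distrib]
  refine sum_le_sum fun T hT => le_trans (le_of_eq ?_) (key T hT)
  rw [← sum_filter, filter_filter]

/-- Induction on `Y`, processing one vertex `t`. Its closed neighbourhood splits into vertices in
its own `F`-component, paid for by the power of two, and vertices `u` outside, for which the edge
`tu` extends the forest. Since `Y` meets each component at most once, the component of `t` is
charged only when `t` is processed. -/
theorem prod_degree_add_one_le_treeWeight {G : SimpleGraph W} (hG : G.Connected) (Y : Finset W) :
    ∀ F : SimpleGraph W, F ≤ G → F.IsAcyclic →
      (∀ t ∈ Y, ∀ t' ∈ Y, F.Reachable t t' → t = t') →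
      ∏ t ∈ Y, (G.degree t + 1) ≤
        2 ^ #{v | ∃ t ∈ Y, F.Reachable v t} * treeWeight G Y F := by
  induction Y using Finset.strongInduction with
  | H Y ih =>
  intro F hFG hF hY
  rcases Y.eq_empty_or_nonempty with rfl | ⟨t, ht⟩
  · obtain ⟨T, hTG, hT, hFT⟩ : ∃ T ≤ G, T.IsTree ∧ F ≤ T := by
      obtain ⟨T, h⟩ := hG.exists_isTree_le_of_le_of_isAcyclic hFG hF
      exact ⟨T, by tauto, by tauto, by tauto⟩
    have : 0 < treeWeight G ∅ F :=
      sum_pos (fun _ _ => prod_pos fun _ _ => by positivity)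
        ⟨T, mem_treesBetween.2 ⟨hT, hFT, hTG⟩⟩
    simpa [Nat.one_le_iff_ne_zero] using this.ne'
  have hss : Y.erase t ⊂ Y := erase_ssubset ht
  set A : Finset W := {v | ∃ t ∈ Y, F.Reachable v t} with hA
  set C : Finset W := {v | F.Reachable t v} with hC
  set U : Finset W := {u | G.Adj t u ∧ ¬ F.Reachable t u} with hU
  have hdeg : G.degree t + 1 ≤ #C + #U := by
    rw [← card_union_of_disjoint]
    · rw [← SimpleGraph.card_neighborFinset_eq_degree,
        ← card_insert_of_notMem (G.notMem_neighborFinset_self t)]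
      refine card_le_card fun v hv => ?_
      simp only [mem_insert, SimpleGraph.mem_neighborFinset] at hv
      simp only [hC, hU, mem_union, mem_filter, mem_univ, true_and]
      rcases hv with rfl | hv
      · exact .inl (.refl _)
      · tauto
    · rw [disjoint_left]
      intro v hv hv'
      simp only [hC, hU, mem_filter, mem_univ, true_and] at hv hv'
      exact hv'.2 hv
  have hin : (∏ s ∈ Y.erase t, (G.degree s + 1)) * #C ≤
      2 ^ #A * treeWeight G (Y.erase t) F := by
    set A' : Finset W := {v | ∃ s ∈ Y.erase t, F.Reachable v s} with hA'
    have hcard : #A' + #C ≤ #A := by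
      rw [← card_union_of_disjoint]
      · refine card_le_card fun v hv => ?_
        simp only [hA, hA', hC, mem_union, mem_filter, mem_univ, true_and] at hv ⊢
        rcases hv with ⟨s, hs, hvs⟩ | hv
        · exact ⟨s, mem_of_mem_erase hs, hvs⟩
        · exact ⟨t, ht, hv.symm⟩
      · rw [disjoint_left]
        intro v hv hv'
        simp only [hA', hC, mem_filter, mem_univ, true_and] at hv hv'
        obtain ⟨s, hs, hvs⟩ := hv
        exact ne_of_mem_erase hs (hY t ht s (mem_of_mem_erase hs) (hv'.trans hvs)).symm
    -- Dropping `t` frees the `#C` vertices of its component from the exponent, and `#C ≤ 2 ^ #C`.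
    calc (∏ s ∈ Y.erase t, (G.degree s + 1)) * #C
        ≤ (2 ^ #A' * treeWeight G (Y.erase t) F) * 2 ^ #C := by
          refine Nat.mul_le_mul (ih _ hss F hFG hF fun s hs s' hs' => ?_) Nat.lt_two_pow_self.le
          exact hY s (mem_of_mem_erase hs) s' (mem_of_mem_erase hs')
      _ = 2 ^ (#A' + #C) * treeWeight G (Y.erase t) F := by ring
      _ ≤ _ := by gcongr; norm_num
  have hout : ∀ u ∈ U, ∏ s ∈ Y.erase t, (G.degree s + 1) ≤
      2 ^ #A * treeWeight G (Y.erase t) (F ⊔ SimpleGraph.edge t u) := by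
    intro u hu
    simp only [hU, mem_filter, mem_univ, true_and] at hu
    have hne : ∀ s ∈ Y.erase t, ¬ F.Reachable s t := fun s hs h =>
      ne_of_mem_erase hs (hY s (mem_of_mem_erase hs) t ht h)
    refine (ih _ hss (F ⊔ SimpleGraph.edge t u) ?_ ?_ ?_).trans ?_
    · refine sup_le hFG ?_
      rw [SimpleGraph.edge_le_iff]
      exact .inr hu.1
    · exact hF.sup_edge_of_not_reachable hu.2
    · intro s hs s' hs' h
      rcases reachable_sup_edge h with h | ⟨h, -⟩ | ⟨-, h⟩
      · exact hY s (mem_of_mem_erase hs) s' (mem_of_mem_erase hs') h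
      · exact (hne s hs h).elim
      · exact (hne s' hs' h.symm).elim
    -- Joining `t` to `u` can newly attach to `Y.erase t` only vertices of the component of `t`,
    -- which `A` already counts because `t ∈ Y`.
    · gcongr
      · norm_num
      · intro v hv
        simp only [hA, mem_filter, mem_univ, true_and] at hv ⊢
        obtain ⟨s, hs, hvs⟩ := hv
        rcases reachable_sup_edge hvs with h | ⟨h, -⟩ | ⟨-, h⟩
        · exact ⟨s, mem_of_mem_erase hs, h⟩
        · exact ⟨t, ht, h⟩
        · exact (hne s hs h.symm).elim
  rw [← mul_prod_erase Y _ ht]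
  calc (G.degree t + 1) * ∏ s ∈ Y.erase t, (G.degree s + 1)
      ≤ (#C + #U) * ∏ s ∈ Y.erase t, (G.degree s + 1) := by gcongr
    _ = (∏ s ∈ Y.erase t, (G.degree s + 1)) * #C +
          ∑ _u ∈ U, ∏ s ∈ Y.erase t, (G.degree s + 1) := by
        rw [sum_const, smul_eq_mul]; ring
    _ ≤ 2 ^ #A * treeWeight G (Y.erase t) F +
          ∑ u ∈ U, 2 ^ #A * treeWeight G (Y.erase t) (F ⊔ SimpleGraph.edge t u) :=
        Nat.add_le_add hin (sum_le_sum hout)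
    _ ≤ 2 ^ #A * treeWeight G Y F := by
        rw [← mul_sum, ← mul_add]
        gcongr
        exact treeWeight_erase_add_sum_le G F Y ht

/-- A connected graph has at least `∏ (deg s + 1) / 6 ^ (|W| - 1)` spanning trees, where the
product is over all vertices but one. -/
theorem prod_degree_add_one_le_card_trees {G : SimpleGraph W} (hG : G.Connected) (r : W) :
    ∏ t ∈ univ.erase r, (G.degree t + 1) ≤
      6 ^ (Fintype.card W - 1) * #(treesBetween ⊥ G) := by
  refine (prod_degree_add_one_le_treeWeight hG (univ.erase r) ⊥ bot_le
    SimpleGraph.isAcyclic_bot fun t _ t' _ h => by simpa using h).trans ?_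
  have h2 : treeWeight G (univ.erase r) ⊥ ≤ ∑ _T ∈ treesBetween ⊥ G, 3 ^ (Fintype.card W - 1) := by
    refine sum_le_sum fun T hT => ?_
    have hT := (mem_treesBetween.1 hT).1
    -- Three labels at most: blank or one of two endpoints.
    refine (prod_le_pow_card _ _ 3 fun e _ => ?_).trans (Nat.pow_le_pow_right (by norm_num) ?_)
    · have : #{t ∈ univ.erase r | t ∈ e} ≤ #e.toFinset :=
        card_le_card fun t ht => by simpa using (mem_filter.1 ht).2
      have := this.trans (Sym2.card_toFinset e).le
      split_ifs at this <;> omega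
    · have := hT.card_edgeFinset
      exact (card_le_card sdiff_subset).trans (by omega)
  calc _ ≤ 2 ^ (Fintype.card W - 1) * ∑ _T ∈ treesBetween ⊥ G, 3 ^ (Fintype.card W - 1) := by
        refine Nat.mul_le_mul (Nat.pow_le_pow_right two_pos (le_of_eq ?_)) h2
        rw [← card_univ, ← card_erase_of_mem (mem_univ r)]
        congr 1
        ext v
        simp
    _ = (2 * 3) ^ (Fintype.card W - 1) * #(treesBetween ⊥ G) := by
      rw [sum_const, smul_eq_mul, mul_pow]; ring
    _ = _ := by norm_num

end SpanningTrees

/-! ### Trees as parent functions -/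

/-- A parent function on `ι` with root `none` is ranked if iterating it always ends at the root,
as witnessed by a rank that decreases from each element to its parent. -/
def IsRanked {ι : Type*} (p : ι → Option ι) : Prop :=
  ∃ ρ : Option ι → ℕ, ∀ s, ρ (p s) < ρ (some s)

section ParentFunctions

open Classical

variable {ι : Type*}

theorem exists_isRanked_of_connected {T : SimpleGraph (Option ι)} (hT : T.Connected) :
    ∃ p : ι → Option ι, IsRanked p ∧ ∀ s, T.Adj (some s) (p s) := by
  have h : ∀ s : ι, ∃ o, T.Adj (some s) o ∧ T.dist o none < T.dist (some s) none := by
    intro s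
    -- The parent is the first step of a geodesic to the root.
    obtain ⟨w, hw⟩ := hT.exists_walk_length_eq_dist (some s) none
    cases w with
    | cons hadj q =>
      refine ⟨_, hadj, ?_⟩
      rw [← hw, SimpleGraph.Walk.length_cons]
      exact Nat.lt_succ_of_le (SimpleGraph.dist_le q)
  choose p hp hlt using h
  exact ⟨p, ⟨fun o => T.dist o none, hlt⟩, hp⟩

variable [Fintype ι]

/-- The edges to parents are distinct, since a coincidence would make two vertices each other's
parent, against the rank. There are as many of them as edges of the tree. Hence the parent function
determines the tree. -/
theorem edgeFinset_eq_of_isRanked {T : SimpleGraph (Option ι)} (hT : T.IsTree)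
    {p : ι → Option ι} (hp : IsRanked p) (h : ∀ s, T.Adj (some s) (p s)) :
    T.edgeFinset = univ.image fun s => s(some s, p s) := by
  obtain ⟨ρ, hρ⟩ := hp
  symm
  refine eq_of_subset_of_card_le ?_ ?_
  · intro e he
    obtain ⟨s, -, rfl⟩ := mem_image.1 he
    simpa using h s
  · rw [card_image_of_injective]
    · have := hT.card_edgeFinset
      rw [Fintype.card_option] at this
      rw [card_univ]
      omega
    · intro s t hst
      rcases Sym2.eq_iff.1 hst with ⟨h1, -⟩ | ⟨h1, h2⟩
      · exact Option.some_injective _ h1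
      · have hs := hρ s
        have ht := hρ t
        rw [h2] at hs
        rw [← h1] at ht
        omega

theorem card_trees_le_card_isRanked (G : SimpleGraph (Option ι)) :
    #(treesBetween ⊥ G) ≤
      #{p : ι → Option ι | IsRanked p ∧ ∀ s, G.Adj (some s) (p s)} := by
  have h : ∀ T : SimpleGraph (Option ι), ∃ p : ι → Option ι, T.IsTree →
      IsRanked p ∧ ∀ s, T.Adj (some s) (p s) := by
    intro T
    by_cases hT : T.IsTree
    · obtain ⟨p, hp⟩ := exists_isRanked_of_connected hT.connected
      exact ⟨p, fun _ => hp⟩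
    · exact ⟨fun _ => none, fun h => (hT h).elim⟩
  choose P hP using h
  refine card_le_card_of_injOn P (fun T hT => ?_) fun T hT T' hT' hTT' => ?_
  · have hT := mem_treesBetween.1 hT
    simpa using ⟨(hP T hT.1).1, fun s => hT.2.2 ((hP T hT.1).2 s)⟩
  · have hT := (mem_treesBetween.1 hT).1
    have hT' := (mem_treesBetween.1 hT').1
    have h1 := edgeFinset_eq_of_isRanked hT (hP T hT).1 (hP T hT).2
    have h2 := edgeFinset_eq_of_isRanked hT' (hP T' hT').1 (hP T' hT').2
    rw [← hTT', ← h1] at h2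
    exact (SimpleGraph.edgeFinset_inj.1 h2).symm

end ParentFunctions

/-! ### Summing over set families along a fixed tree -/

section TreeSum

/-- Coordinates outside `S` are pinned to the dummy value `∅`, so that partial sums stay over
functions on all of `ι`. -/
theorem sum_piFinset_insert {V ι : Type*} [Fintype ι] [DecidableEq ι]
    (E : Finset (Finset V)) {S : Finset ι} {a : ι} (ha : a ∉ S)
    (f : (ι → Finset V) → ℝ) :
    ∑ Z ∈ Fintype.piFinset (fun s => if s ∈ insert a S then E else {∅}), f Z =
      ∑ Z ∈ Fintype.piFinset (fun s => if s ∈ S then E else {∅}),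
        ∑ z ∈ E, f (Function.update Z a z) := by
  rw [← sum_product']
  refine sum_nbij' (fun Z => (Function.update Z a ∅, Z a)) (fun q => Function.update q.1 a q.2)
    ?_ ?_ ?_ ?_ ?_
  · intro Z hZ
    rw [Fintype.mem_piFinset] at hZ
    rw [mem_product, Fintype.mem_piFinset]
    refine ⟨fun s => ?_, by simpa using hZ a⟩
    rcases eq_or_ne s a with rfl | hs
    · simp [ha]
    · simpa [hs] using hZ s
  · rintro ⟨Z, z⟩ hZ
    rw [mem_product, Fintype.mem_piFinset] at hZ
    rw [Fintype.mem_piFinset]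
    intro s
    rcases eq_or_ne s a with rfl | hs
    · simpa using hZ.2
    · simpa [hs] using hZ.1 s
  · intro Z _
    simp
  · rintro ⟨Z, z⟩ hZ
    rw [mem_product, Fintype.mem_piFinset] at hZ
    have : Z a = ∅ := by simpa [ha] using hZ.1 a
    simp [← this]
  · intro Z _
    simp

variable {V : Type*} [DecidableEq V]

/-- The family `Z` together with the set `L` at the additional index `none`. -/
def adjoinRoot {ι : Type*} (L : Finset V) (Z : ι → Finset V) (o : Option ι) : Finset V :=
  o.elim L Z

theorem sum_overlap_le {E : Finset (Finset V)} {φ : Finset V → ℝ} (hφ : ∀ Z, 0 ≤ φ Z) {γ : ℝ}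
    (hsum : ∀ i : V, ∑ Z ∈ E with i ∈ Z, φ Z ≤ γ) (Y : Finset V) :
    ∑ Z ∈ E, (if Overlap Z Y then φ Z else 0) ≤ γ * #Y := by
  calc ∑ Z ∈ E, (if Overlap Z Y then φ Z else 0)
      ≤ ∑ Z ∈ E, ∑ i ∈ Y, if i ∈ Z then φ Z else 0 := by
        refine sum_le_sum fun Z _ => ?_
        split_ifs with h
        · obtain ⟨i, hi⟩ := h
          rw [mem_inter] at hi
          refine le_trans (le_of_eq ?_) (single_le_sum (fun j _ => ?_) hi.2)
          · rw [if_pos hi.1]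
          · split_ifs
            exacts [hφ Z, le_rfl]
        · refine sum_nonneg fun i _ => ?_
          split_ifs
          exacts [hφ Z, le_rfl]
    _ = ∑ i ∈ Y, ∑ Z ∈ E with i ∈ Z, φ Z := by
        rw [sum_comm]
        exact sum_congr rfl fun i _ => (sum_filter _ _).symm
    _ ≤ ∑ _i ∈ Y, γ := sum_le_sum fun i _ => hsum i
    _ = γ * #Y := by rw [sum_const, nsmul_eq_mul, mul_comm]

variable {ι : Type*} [Fintype ι] [DecidableEq ι]

theorem sum_prod_overlap_le_of_closed {E : Finset (Finset V)} {φ : Finset V → ℝ}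
    (hφ : ∀ Z, 0 ≤ φ Z) {γ : ℝ} (hγ : 0 ≤ γ) (hsum : ∀ i : V, ∑ Z ∈ E with i ∈ Z, φ Z ≤ γ)
    {k : ℕ} (hE : ∀ Z ∈ E, #Z ≤ k) (L : Finset V) {p : ι → Option ι} (hp : IsRanked p)
    (S : Finset ι) (hS : ∀ s ∈ S, ∀ t, p s = some t → t ∈ S) :
    ∑ Z ∈ Fintype.piFinset (fun s => if s ∈ S then E else {∅}),
        ∏ s ∈ S, (if Overlap (Z s) (adjoinRoot L Z (p s)) then φ (Z s) else 0) ≤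
      ∏ s ∈ S, γ * ((p s).elim (#L : ℝ) fun _ => (k : ℝ)) := by
  obtain ⟨ρ, hρ⟩ := hp
  induction S using Finset.strongInduction with
  | H S ih =>
  rcases S.eq_empty_or_nonempty with rfl | hne
  · simp
  -- An index of maximal rank is a leaf: no element of `S` has it as parent, so its set occurs in a
  -- single factor and can be summed first.
  obtain ⟨a, haS, hmax⟩ := exists_max_image S (fun s => ρ (some s)) hne
  have hpa : ∀ s ∈ S, p s ≠ some a := by
    intro s hs h
    have h1 := hρ s
    have h2 := hmax s hs
    rw [h] at h1
    omega
  obtain ⟨S', ha, rfl⟩ : ∃ S', a ∉ S' ∧ S = insert a S' :=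
    ⟨S.erase a, notMem_erase a S, (insert_erase haS).symm⟩
  have hroot : ∀ s ∈ insert a S', ∀ (Z : ι → Finset V) z,
      adjoinRoot L (Function.update Z a z) (p s) = adjoinRoot L Z (p s) := by
    intro s hs Z z
    have := hpa s hs
    cases h : p s with
    | none => rfl
    | some t =>
      rw [h] at this
      exact Function.update_of_ne (fun h' => this (congrArg some h')) _ _
  rw [sum_piFinset_insert E ha, prod_insert ha]
  set c : ℝ := (p a).elim (#L : ℝ) fun _ => (k : ℝ) with hc
  have hc0 : 0 ≤ c := by
    rw [hc]; cases p a <;> simp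
  have hS' : ∀ s ∈ S', ∀ t, p s = some t → t ∈ S' := by
    intro s hs t hst
    have h := hS s (mem_insert_of_mem hs) t hst
    refine (mem_insert.1 h).resolve_left fun h' => ?_
    exact hpa s (mem_insert_of_mem hs) (h' ▸ hst)
  calc _ = ∑ Z ∈ Fintype.piFinset (fun s => if s ∈ S' then E else {∅}),
        (∑ z ∈ E, if Overlap z (adjoinRoot L Z (p a)) then φ z else 0) *
          ∏ s ∈ S', (if Overlap (Z s) (adjoinRoot L Z (p s)) then φ (Z s) else 0) := by
        refine sum_congr rfl fun Z _ => ?_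
        rw [sum_mul]
        refine sum_congr rfl fun z _ => ?_
        rw [prod_insert ha, hroot a (mem_insert_self _ _), Function.update_self]
        congr 1
        refine prod_congr rfl fun s hs => ?_
        rw [hroot s (mem_insert_of_mem hs),
          Function.update_of_ne (ne_of_mem_of_not_mem hs ha)]
    _ ≤ ∑ Z ∈ Fintype.piFinset (fun s => if s ∈ S' then E else {∅}), (γ * c) *
          ∏ s ∈ S', (if Overlap (Z s) (adjoinRoot L Z (p s)) then φ (Z s) else 0) := by
        refine sum_le_sum fun Z hZ => mul_le_mul_of_nonneg_right ?_ ?_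
        · refine (sum_overlap_le hφ hsum _).trans (mul_le_mul_of_nonneg_left ?_ hγ)
          cases h : p a with
          | none => simp [hc, h, adjoinRoot]
          | some t =>
            have ht : t ∈ S' := by
              refine (mem_insert.1 (hS a (mem_insert_self _ _) t h)).resolve_left fun h' => ?_
              exact hpa a (mem_insert_self _ _) (h' ▸ h)
            have hZt := Fintype.mem_piFinset.1 hZ t
            rw [if_pos ht] at hZt
            simpa [hc, h, adjoinRoot] using hE _ hZt
        · refine prod_nonneg fun s _ => ?_
          split_ifs
          exacts [hφ _, le_rfl]
    _ ≤ (γ * c) * ∏ s ∈ S', γ * ((p s).elim (#L : ℝ) fun _ => (k : ℝ)) := by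
        rw [← mul_sum]
        refine mul_le_mul_of_nonneg_left ?_ (mul_nonneg hγ hc0)
        exact ih S' (ssubset_insert ha) hS'

theorem sum_prod_overlap_le {E : Finset (Finset V)} {φ : Finset V → ℝ}
    (hφ : ∀ Z, 0 ≤ φ Z) {γ : ℝ} (hγ : 0 ≤ γ) (hsum : ∀ i : V, ∑ Z ∈ E with i ∈ Z, φ Z ≤ γ)
    {k : ℕ} (hE : ∀ Z ∈ E, #Z ≤ k) (L : Finset V) {p : ι → Option ι} (hp : IsRanked p) :
    ∑ Z ∈ Fintype.piFinset (fun _ : ι => E),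
        ∏ s, (if Overlap (Z s) (adjoinRoot L Z (p s)) then φ (Z s) else 0) ≤
      ∏ s, γ * ((p s).elim (#L : ℝ) fun _ => (k : ℝ)) := by
  simpa using sum_prod_overlap_le_of_closed hφ hγ hsum hE L hp univ (by simp)

theorem sum_prod_elim (γ a b : ℝ) :
    ∑ p : ι → Option ι, ∏ s, γ * ((p s).elim a fun _ => b) =
      (γ * (a + Fintype.card ι * b)) ^ Fintype.card ι := by
  have h := Finset.prod_univ_sum (fun _ : ι => (univ : Finset (Option ι)))
    (fun _ o => γ * (o.elim a fun _ => b))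
  rw [Fintype.piFinset_univ] at h
  rw [← h]
  simp [Fintype.sum_option, mul_add, mul_left_comm]

end TreeSum

/-! ### From connected clusters to trees -/

section Families

theorem cons_map_eq_map_adjoinRoot {V ι : Type*} [Fintype ι] (L : Finset V) (Z : ι → Finset V) :
    L ::ₘ (univ : Finset ι).val.map Z =
      (univ : Finset (Option ι)).val.map (adjoinRoot L Z) := by
  rw [univ_option]
  simp [adjoinRoot, insertNone, Multiset.map_map, Function.comp_def]

variable {V : Type*} [DecidableEq V] {ι : Type*}

/-- The overlap graph of a family of subsets. -/
def overlapGraph (Y : ι → Finset V) : SimpleGraph ι :=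
  SimpleGraph.fromRel fun s t => Overlap (Y s) (Y t)

theorem Overlap.symm {X Y : Finset V} (h : Overlap X Y) : Overlap Y X := by
  rwa [Overlap, inter_comm]

theorem overlapGraph_adj {Y : ι → Finset V} {s t : ι} :
    (overlapGraph Y).Adj s t ↔ s ≠ t ∧ Overlap (Y s) (Y t) := by
  rw [overlapGraph, SimpleGraph.fromRel_adj]
  exact ⟨fun h => ⟨h.1, h.2.elim id Overlap.symm⟩, fun h => ⟨h.1, .inl h.2⟩⟩

theorem reachable_of_overlap {Y : ι → Finset V} {s t : ι} (h : Overlap (Y s) (Y t)) :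
    (overlapGraph Y).Reachable s t := by
  rcases eq_or_ne s t with rfl | hne
  · exact .refl _
  · exact (overlapGraph_adj.2 ⟨hne, h⟩).reachable

theorem reachable_of_isChain {Y : ι → Finset V} (l : List (Finset V)) :
    ∀ (hl : l ≠ []), (∀ Z ∈ l, ∃ s, Y s = Z) → l.IsChain Overlap →
      ∀ u v, Overlap (l.head hl) (Y u) → Overlap (l.getLast hl) (Y v) →
        (overlapGraph Y).Reachable u v := by
  induction l with
  | nil => exact fun hl => (hl rfl).elim
  | cons Z l ih =>
    intro hl hmem hchain u v hu hv
    obtain ⟨s, rfl⟩ := hmem Z (by simp)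
    have hus : (overlapGraph Y).Reachable u s := reachable_of_overlap hu.symm
    cases l with
    | nil => exact hus.trans (reachable_of_overlap hv)
    | cons Z' l =>
      rw [List.isChain_cons_cons] at hchain
      exact hus.trans (ih (by simp) (fun W hW => hmem W (by simp [hW])) hchain.2 s v
        hchain.1.symm (by simpa using hv))

variable [Fintype ι]

theorem overlapGraph_preconnected {Y : ι → Finset V}
    (h : IsConnected ((univ : Finset ι).val.map Y)) : (overlapGraph Y).Preconnected := by
  intro u v
  rcases eq_or_ne u v with rfl | hne
  · exact .refl _
  -- Comparing indices rather than sets also covers `Y u = Y v`, where the set has multiplicity at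
  -- least two.
  have hle : ({u, v} : Multiset ι) ≤ (univ : Finset ι).val := by
    refine (Multiset.le_iff_subset ?_).2 fun _ _ => mem_univ _
    simpa using hne
  obtain ⟨l, hl, -, hmem, hu, hv, hchain⟩ := h (Y u) (Y v) (by
    simpa using Multiset.map_le_map (f := Y) hle)
  exact reachable_of_isChain l hl (fun Z hZ => by simpa using hmem Z hZ) hchain u v hu hv

/-- The extra one accounts for the overlap of `Y s` with itself. -/
theorem overlapCount_le_degree_add_one (Y : ι → Finset V) (s : ι)
    [Fintype ((overlapGraph Y).neighborSet s)] :
    overlapCount (Y s) ((univ : Finset ι).val.map Y) ≤ (overlapGraph Y).degree s + 1 := by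
  classical
  rw [overlapCount, Multiset.filter_map, Multiset.card_map,
    ← SimpleGraph.card_neighborFinset_eq_degree,
    ← card_insert_of_notMem ((overlapGraph Y).notMem_neighborFinset_self s)]
  refine card_le_card (s := univ.filter ((fun Z => Overlap Z (Y s)) ∘ Y)) fun t ht => ?_
  simp only [Function.comp_apply, mem_filter, mem_univ, true_and] at ht
  rw [mem_insert, SimpleGraph.mem_neighborFinset, overlapGraph_adj]
  rcases eq_or_ne t s with h | h
  · exact .inl h
  · exact .inr ⟨h.symm, ht.symm⟩

theorem prod_overlapCount_le [DecidableEq ι] (L : Finset V) (Z : ι → Finset V)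
    (h : IsConnected (L ::ₘ (univ : Finset ι).val.map Z)) [DecidablePred (IsRanked (ι := ι))] :
    ∏ s, overlapCount (Z s) (L ::ₘ (univ : Finset ι).val.map Z) ≤
      6 ^ Fintype.card ι *
        #{p : ι → Option ι | IsRanked p ∧ ∀ s, Overlap (Z s) (adjoinRoot L Z (p s))} := by
  classical
  rw [cons_map_eq_map_adjoinRoot] at h ⊢
  set Y := adjoinRoot L Z with hY
  have hconn : (overlapGraph Y).Connected := ⟨overlapGraph_preconnected h⟩
  have h1 := prod_degree_add_one_le_card_trees hconn none
  have h2 : ∀ inst : DecidableEq (Option ι),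
      @Finset.erase _ inst univ none = univ.map Function.Embedding.some := by
    intro _; ext o; cases o <;> simp
  rw [h2, prod_map, Fintype.card_option, Nat.add_sub_cancel] at h1
  calc ∏ s, overlapCount (Z s) ((univ : Finset (Option ι)).val.map Y)
      ≤ ∏ s, ((overlapGraph Y).degree (some s) + 1) :=
        prod_le_prod' fun s _ => overlapCount_le_degree_add_one Y (some s)
    _ ≤ 6 ^ Fintype.card ι * #(treesBetween ⊥ (overlapGraph Y)) := h1
    _ ≤ _ := by
        gcongr
        refine (card_trees_le_card_isRanked _).trans (card_le_card fun p hp => ?_)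
        simp only [mem_filter, mem_univ, true_and] at hp ⊢
        exact ⟨hp.1, fun s => (overlapGraph_adj.1 (hp.2 s)).2⟩

theorem sum_prod_overlapCount_le [DecidableEq ι] {E : Finset (Finset V)} {φ : Finset V → ℝ}
    (hφ : ∀ Z, 0 ≤ φ Z) {γ : ℝ} (hγ : 0 ≤ γ) (hsum : ∀ i : V, ∑ Z ∈ E with i ∈ Z, φ Z ≤ γ)
    {k : ℕ} (hE : ∀ Z ∈ E, #Z ≤ k) (L : Finset V) (C : Finset (ι → Finset V))
    (hCE : ∀ Z ∈ C, ∀ s, Z s ∈ E)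
    (hC : ∀ Z ∈ C, IsConnected (L ::ₘ (univ : Finset ι).val.map Z)) :
    ∑ Z ∈ C, ∏ s, (overlapCount (Z s) (L ::ₘ (univ : Finset ι).val.map Z) : ℝ) * φ (Z s) ≤
      (6 * (γ * (#L + Fintype.card ι * k))) ^ Fintype.card ι := by
  classical
  have hnn : ∀ (Z : ι → Finset V) p s,
      0 ≤ (if Overlap (Z s) (adjoinRoot L Z p) then φ (Z s) else 0) := by
    intro Z p s
    split_ifs
    exacts [hφ _, le_rfl]
  have hZ : ∀ Z ∈ C,
      ∏ s, (overlapCount (Z s) (L ::ₘ (univ : Finset ι).val.map Z) : ℝ) * φ (Z s) ≤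
        6 ^ Fintype.card ι * ∑ p : ι → Option ι with IsRanked p,
          ∏ s, (if Overlap (Z s) (adjoinRoot L Z (p s)) then φ (Z s) else 0) := by
    intro Z hZ
    have h1 : (∏ s, (overlapCount (Z s) (L ::ₘ (univ : Finset ι).val.map Z) : ℝ)) ≤
        6 ^ Fintype.card ι *
          #{p : ι → Option ι | IsRanked p ∧ ∀ s, Overlap (Z s) (adjoinRoot L Z (p s))} := by
      exact_mod_cast prod_overlapCount_le L Z (hC Z hZ)
    rw [prod_mul_distrib]
    refine (mul_le_mul_of_nonneg_right h1 (prod_nonneg fun s _ => hφ _)).trans (le_of_eq ?_)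
    rw [mul_assoc, ← nsmul_eq_mul, ← sum_const, ← filter_filter, sum_filter]
    congr 1
    refine sum_congr rfl fun p _ => ?_
    split_ifs with h
    · exact prod_congr rfl fun s _ => (if_pos (h s)).symm
    · obtain ⟨s, hs⟩ := not_forall.1 h
      exact (prod_eq_zero (mem_univ s) (if_neg hs)).symm
  calc _ ≤ ∑ Z ∈ C, 6 ^ Fintype.card ι * ∑ p : ι → Option ι with IsRanked p,
          ∏ s, (if Overlap (Z s) (adjoinRoot L Z (p s)) then φ (Z s) else 0) := sum_le_sum hZ
    _ = 6 ^ Fintype.card ι * ∑ p : ι → Option ι with IsRanked p, ∑ Z ∈ C,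
          ∏ s, (if Overlap (Z s) (adjoinRoot L Z (p s)) then φ (Z s) else 0) := by
        rw [← mul_sum, sum_comm]
    _ ≤ 6 ^ Fintype.card ι * ∑ p : ι → Option ι,
          ∏ s, γ * ((p s).elim (#L : ℝ) fun _ => (k : ℝ)) := by
        -- Rankedness is needed to bound each term; once bounded, the sum is enlarged to all
        -- functions so that it factorizes.
        gcongr 6 ^ Fintype.card ι * ?_
        refine (sum_le_sum fun p hp => ?_).trans
          (sum_le_sum_of_subset_of_nonneg (filter_subset _ _) fun p _ _ => ?_)
        · refine le_trans ?_ (sum_prod_overlap_le hφ hγ hsum hE L (mem_filter.1 hp).2)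
          refine sum_le_sum_of_subset_of_nonneg (fun Z hZ => ?_) fun Z _ _ => ?_
          · exact Fintype.mem_piFinset.2 (hCE Z hZ)
          · exact prod_nonneg fun s _ => hnn Z _ s
        · refine prod_nonneg fun s _ => mul_nonneg hγ ?_
          cases p s <;> simp
    _ = _ := by rw [sum_prod_elim, mul_pow 6]

/-! ### Passing to sequences, and the final numerical estimate -/

theorem numPerms_eq_card_functions [Fintype V]
    (G : Multiset (Finset V)) {m : ℕ} (hm : G.card = m) :
    numPerms G = #{Z : Fin m → Finset V | (univ : Finset (Fin m)).val.map Z = G} := by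
  subst hm
  have hofFn : ∀ Z : Fin G.card → Finset V,
      (List.ofFn Z : Multiset (Finset V)) = univ.val.map Z := by
    intro Z
    rw [Fin.univ_val_map]
  refine (card_nbij (fun Z => List.ofFn Z) (fun Z hZ => ?_) (fun Z _ Z' _ h => ?_)
    fun l hl => ?_).symm
  · have hZ := (mem_filter.1 hZ).2
    exact mem_lists_toFinset.2 ((hofFn Z).trans hZ)
  · exact List.ofFn_injective h
  · have hl : (l : Multiset (Finset V)) = G := mem_lists_toFinset.1 hl
    have hlen : l.length = G.card := by rw [← hl, Multiset.coe_card]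
    refine ⟨fun i => l.get (i.cast hlen.symm), ?_, ?_⟩
    · have : List.ofFn (fun i : Fin G.card => l.get (i.cast hlen.symm)) = l := by
        apply List.ext_get <;> simp [hlen]
      simp only [coe_filter, mem_univ, true_and, Set.mem_ofPred_eq]
      rw [← hofFn, this, hl]
    · apply List.ext_get <;> simp [hlen]

theorem sum_numPerms_mul_eq [Fintype V] {m : ℕ}
    (𝒢 : Finset (Multiset (Finset V))) (h𝒢 : ∀ G ∈ 𝒢, G.card = m) (F : Multiset (Finset V) → ℝ) :
    ∑ G ∈ 𝒢, (numPerms G : ℝ) * F G =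
      ∑ Z : Fin m → Finset V with univ.val.map Z ∈ 𝒢, F (univ.val.map Z) := by
  rw [← sum_fiberwise_of_maps_to (t := 𝒢) (g := fun Z : Fin m → Finset V => univ.val.map Z)
    fun Z hZ => (mem_filter.1 hZ).2]
  refine sum_congr rfl fun G hG => ?_
  rw [numPerms_eq_card_functions G (h𝒢 G hG), ← nsmul_eq_mul, ← sum_const, filter_filter]
  refine sum_congr ?_ fun Z hZ => ?_
  · ext Z
    simp only [mem_filter, mem_univ, true_and]
    exact ⟨fun h => ⟨h ▸ hG, h⟩, And.right⟩
  · rw [(mem_filter.1 hZ).2.2]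

/-- With `y = x / k + m`, this is `y ^ m / m! ≤ exp y`. The argument gives the constants `e` and
`6e`, well below those stated. -/
theorem pow_mul_add_le_exp_mul_factorial {γ x : ℝ} (hγ : 0 ≤ γ) (hx : 0 ≤ x) {k m : ℕ}
    (hk : 1 ≤ k) :
    (6 * (γ * (x + m * k))) ^ m ≤
      Real.exp 405 ^ (x / k) * (Real.exp 1231 * γ * k) ^ m * m.factorial := by
  have hk0 : (0 : ℝ) < k := by exact_mod_cast hk
  have hxk : 0 ≤ x / k := by positivity
  have hfac : (0 : ℝ) < m.factorial := by positivity
  have h1 : (x / k + m) ^ m ≤ Real.exp (x / k) * Real.exp 1 ^ m * m.factorial := by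
    have := Real.pow_div_factorial_le_exp (x := x / k + m) (by positivity) m
    rw [div_le_iff₀ hfac, Real.exp_add] at this
    rwa [← Real.exp_nat_mul, mul_one]
  have h6 : 6 * Real.exp 1 ≤ Real.exp 1231 := by
    have h : (6 : ℝ) ≤ Real.exp 1230 := by linarith [Real.add_one_le_exp (1230 : ℝ)]
    calc 6 * Real.exp 1 ≤ Real.exp 1230 * Real.exp 1 := by gcongr
      _ = Real.exp 1231 := by rw [← Real.exp_add]; norm_num
  have hexp : Real.exp (x / k) ≤ Real.exp 405 ^ (x / k) := by
    rw [← Real.exp_mul]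
    exact Real.exp_le_exp.2 (by linarith)
  calc (6 * (γ * (x + m * k))) ^ m = (6 * γ * k) ^ m * (x / k + m) ^ m := by
        rw [← mul_pow]; congr 1; field_simp
    _ ≤ (6 * γ * k) ^ m * (Real.exp (x / k) * Real.exp 1 ^ m * m.factorial) := by gcongr
    _ = Real.exp (x / k) * (6 * Real.exp 1 * γ * k) ^ m * m.factorial := by
        simp only [mul_pow]; ring
    _ ≤ _ := by gcongr

end Families
end ClusterSum

theorem propositionS4 {V : Type*} [Fintype V] [DecidableEq V] (k : ℕ) (hk : 1 ≤ k)
    (φ : Finset V → ℝ) (hφ : ∀ Z, 0 ≤ φ Z) (γ : ℝ) (hγ : 0 ≤ γ)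
    (hsum : ∀ i : V, ∑ Z ∈ ClusterSum.subsetsLE V k with i ∈ Z, φ Z ≤ γ)
    (L : Finset V) (m : ℕ) :
    ∑ G ∈ ClusterSum.clusters k m L,
        (ClusterSum.numPerms G : ℝ) *
          (G.map fun Z => (ClusterSum.overlapCount Z (L ::ₘ G) : ℝ) * φ Z).prod ≤
      (Real.exp 405) ^ ((L.card : ℝ) / (k : ℝ)) *
        (Real.exp 1231 * γ * (k : ℝ)) ^ m * (m.factorial : ℝ) := by
  classical
  rw [ClusterSum.sum_numPerms_mul_eq (m := m) _ fun G hG => (ClusterSum.mem_clusters.1 hG).2.1]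
  refine le_trans (le_of_eq ?_) ((ClusterSum.sum_prod_overlapCount_le (ι := Fin m) hφ hγ hsum
    (fun Z hZ => (Finset.mem_filter.1 hZ).2) L
    (Finset.univ.filter fun Z => Finset.univ.val.map Z ∈ ClusterSum.clusters k m L)
    (fun Z hZ s => ?_) fun Z hZ => ?_).trans ?_)
  · refine Finset.sum_congr rfl fun Z _ => ?_
    rw [Multiset.map_map]
    rfl
  · have h := (ClusterSum.mem_clusters.1 (Finset.mem_filter.1 hZ).2).1
    exact Finset.mem_filter.2 ⟨Finset.mem_univ _,
      h _ (Multiset.mem_map_of_mem _ (Finset.mem_univ s))⟩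
  · exact (ClusterSum.mem_clusters.1 (Finset.mem_filter.1 hZ).2).2.2
  · rw [Fintype.card_fin]
    exact ClusterSum.pow_mul_add_le_exp_mul_factorial hγ (Nat.cast_nonneg _) hk
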